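/- Fix $n\ge 1$ and real rates $x_0,x_1,\dots,x_n\ge 0$ with $x_0>0$ and $x_1>0$, and put $y_k=x_0+x_1+\cdots+x_k$. Let $C_n$ be the set of compositions $c=(c_1,\dots,c_\ell)$ of $n$ (tuples of positive integers with sum $n$). For $0\le j\le n-1$ define $T_j:C_n\to C_n$ by \[ T_j(c)=\begin{cases}(1,c_1,\dots,c_{\ell-1},c_\ell-1)& j=0,\\ (c_1,\dots,c_{j-1},c_j+1,c_{j+1},\dots,c_{\ell-1},c_\ell-1)& 1\le j\le \ell-1,\\ c& j\ge \ell,\end{cases} \] where the last part is deleted in the first two cases if $c_\ell=1$. The $n$-ball projection $Y^{(n)}$ of the Hilbert-Galton board is the continuous-time Markov chain on $C_n$ in which $c$ makes a transition to $T_j(c)$ at rate $x_j$ for every $0\le j\le n-1$. For $m\ge 0$, a triangular array of size $m$ is a family $A=(A_{k,j})_{1\le j\le k\le m}$ of nonnegative integers. Put $v_k(A)=\sum_{i=k}^m A_{i,k}$ and $d_k(A)=\sum_{j=1}^k A_{m-k+j,j}$ for $1\le k\le m$. For $m\le n$, define \[ w_x(A)=x_0^m\prod_{k=1}^m \binom{d_k(A)}{A_{m-k+1,1},\dots,A_{m,k}}\frac{x_k^{v_k(A)}}{y_k^{d_k(A)+1}},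 \] with $0^0=1$; the unique array of size $0$ has weight $1$. Let $H_m(r_1,\dots,r_m)$ be the set of triangular arrays of size $m$ with $\sum_{j=1}^i A_{i,j}=r_i$ for all $1\le i\le m$. Theorem. The chain $Y^{(n)}$ is irreducible; it has a unique stationary probability distribution $\pi_{Y^{(n)}}$. For every composition $c=(\gamma_1+1,\dots,\gamma_\ell+1)\in C_n$, \[ \pi_{Y^{(n)}}(c)=\sum_{A\in H_{\ell-1}(\gamma_1,\dots,\gamma_{\ell-1})}w_x(A)-\sum_{s=0}^{\gamma_\ell-1}\ \sum_{A\in H_\ell(\gamma_1,\dots,\gamma_{\ell-1},s)}w_x(A), \] and also \[ \pi_{Y^{(n)}}(c)=\sum_{s=\gamma_\ell}^{\infty}\ \sum_{A\in H_\ell(\gamma_1,\dots,\gamma_{\ell-1},s)}w_x(A), \] the series being convergent. -/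

import Mathlib

open Finset

noncomputable section

namespace HilbertGalton

/-! ### Continuous-time Markov chains on a finite state space -/

section MarkovChain

variable {S : Type*} [Fintype S] [DecidableEq S]

/-- The generator of the continuous-time Markov chain in which every state `c` makes a transition
to `T j c` at rate `x j`, for each `0 ≤ j < m`. (Transitions with `T j c = c` have no effect.) -/
def generator (m : ℕ) (x : ℕ → ℝ) (T : ℕ → S → S) : Matrix S S ℝ :=
  Matrix.of fun c c' => ∑ j ∈ range m,
    x j * ((if T j c = c' then 1 else 0) - (if c = c' then 1 else 0))

/-- The transition function `P_t = exp (t Q)` of the chain with generator `Q`: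
`transitionProb Q t c c'` is the probability of being in `c'` at time `t` when starting in `c`. -/
def transitionProb (Q : Matrix S S ℝ) (t : ℝ) : Matrix S S ℝ :=
  NormedSpace.exp (t • Q)

/-- The chain with generator `Q` is irreducible: from every state it reaches
every state with positive probability. -/
def IsIrreducibleChain (Q : Matrix S S ℝ) : Prop :=
  ∀ c c' : S, ∃ t : ℝ, 0 < t ∧ 0 < transitionProb Q t c c'

/-- `p` is a stationary probability distribution of the chain with generator `Q`:
if the chain starts with law `p` then its law at every time `t ≥ 0` is `p`. -/
def IsStationaryDistribution (Q : Matrix S S ℝ) (p : S → ℝ) : Prop :=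
  (∀ c, 0 ≤ p c) ∧ ∑ c, p c = 1 ∧
    ∀ t : ℝ, 0 ≤ t → ∀ c', ∑ c, p c * transitionProb Q t c c' = p c'

end MarkovChain

/-! ### The `n`-ball projection -/

/-- Remove one ball from the last bin; delete that bin if it becomes empty. -/
def removeBall (l : List ℕ) : List ℕ :=
  if l.getLastD 0 ≤ 1 then l.dropLast else l.dropLast ++ [l.getLastD 0 - 1]

/-- Add a ball: for `j = 0` in a new leftmost bin, for `j ≥ 1` in the `j`-th bin from the left
(bins are numbered from `1`). -/
def addBall : ℕ → List ℕ → List ℕ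
  | 0, l => 1 :: l
  | j + 1, l => l.modify j (· + 1)

theorem removeBall_pos {l : List ℕ} (hl : ∀ i ∈ l, 0 < i) : ∀ i ∈ removeBall l, 0 < i := by
  intro i hi
  unfold removeBall at hi
  split_ifs at hi with h
  · exact hl i (List.mem_of_mem_dropLast hi)
  · rcases List.mem_append.1 hi with hi | hi
    · exact hl i (List.mem_of_mem_dropLast hi)
    · simp only [List.mem_singleton] at hi
      omega

theorem removeBall_sum {l : List ℕ} (hl : ∀ i ∈ l, 0 < i) (h0 : l ≠ []) :
    (removeBall l).sum + 1 = l.sum := by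
  obtain ⟨l', a, rfl⟩ : ∃ l' a, l = l' ++ [a] :=
    ⟨l.dropLast, l.getLast h0, (List.dropLast_append_getLast h0).symm⟩
  have ha : 0 < a := hl a (by simp)
  simp only [removeBall, List.getLastD_concat, List.dropLast_concat]
  split_ifs with h
  · simp only [List.sum_append, List.sum_singleton]; omega
  · simp only [List.sum_append, List.sum_singleton]; omega

theorem removeBall_length (l : List ℕ) : l.length ≤ (removeBall l).length + 1 := by
  unfold removeBall
  split_ifs <;> simp <;> omega

theorem modify_pos (l : List ℕ) (j : ℕ) (hl : ∀ i ∈ l, 0 < i) :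
    ∀ i ∈ l.modify j (· + 1), 0 < i := by
  induction l generalizing j with
  | nil => simp
  | cons a l ih =>
    cases j with
    | zero => intro i hi; simp at hi; grind
    | succ j => intro i hi; simp at hi; grind

theorem modify_sum (l : List ℕ) (j : ℕ) (hj : j < l.length) :
    (l.modify j (· + 1)).sum = l.sum + 1 := by
  induction l generalizing j with
  | nil => simp at hj
  | cons a l ih =>
    cases j with
    | zero => simp; omega
    | succ j =>
      have := ih j (by simpa using hj)
      simp [this]; omega

/-- The map `T_j` on compositions of `n`: if `j` is smaller than the number of bins, one ball is
removed on the right and one is added on the left of the bin number `j + 1`; otherwise nothing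
changes. -/
def T {n : ℕ} (j : ℕ) (c : Composition n) : Composition n :=
  if h : j < c.blocks.length then
    { blocks := addBall j (removeBall c.blocks)
      blocks_pos := by
        intro i hi
        have hp := removeBall_pos (l := c.blocks) (fun i hi => c.blocks_pos hi)
        cases j with
        | zero =>
          rcases List.mem_cons.1 hi with rfl | hi
          · exact Nat.one_pos
          · exact hp i hi
        | succ j => exact modify_pos _ j hp i hi
      blocks_sum := by
        have hs := removeBall_sum (l := c.blocks) (fun i hi => c.blocks_pos hi)
          (List.ne_nil_of_length_pos (by omega))
        have hlen := removeBall_length c.blocks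
        rw [c.blocks_sum] at hs
        cases j with
        | zero => simp only [addBall, List.sum_cons]; omega
        | succ j => simp only [addBall]; rw [modify_sum _ _ (by omega)]; exact hs }
  else c

/-- The generator of the `n`-ball projection `Y^(n)` of the Hilbert-Galton board with rates `x`:
the composition `c` of `n` makes a transition to `T_j(c)` at rate `x_j`, for `0 ≤ j ≤ n - 1`. -/
def ballProjection (n : ℕ) (x : ℕ → ℝ) : Matrix (Composition n) (Composition n) ℝ :=
  generator n x T

/-! ### Triangular arrays -/

/-- Triangular arrays `(A_{k,j})_{1 ≤ j ≤ k ≤ n}` of nonnegative integers, stored with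
indices shifted by one: `A_{k,j}` is `A (k - 1) (j - 1)`. -/
abbrev TriangularArray (n : ℕ) : Type := (k : Fin n) → Fin (k.val + 1) → ℕ

namespace TriangularArray

variable {n : ℕ}

/-- The entry `A_{k,j}`, for `1 ≤ j ≤ k ≤ n`. -/
def entry (A : TriangularArray n) (k j : ℕ) : ℕ :=
  if h : 1 ≤ j ∧ j ≤ k ∧ k ≤ n then A ⟨k - 1, by omega⟩ ⟨j - 1, by simp only; omega⟩ else 0

/-- Horizontal sums `h_i(A)`. -/
def h (A : TriangularArray n) (i : ℕ) : ℕ := ∑ j ∈ Icc 1 i, A.entry i j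

/-- Vertical sums `v_i(A)`. -/
def v (A : TriangularArray n) (i : ℕ) : ℕ := ∑ k ∈ Icc i n, A.entry k i

/-- Diagonal sums `d_i(A)`, for `1 ≤ i ≤ n`. -/
def d (A : TriangularArray n) (i : ℕ) : ℕ := ∑ j ∈ Icc 1 i, A.entry (n - i + j) j

end TriangularArray

/-- The finite set `H_n(r_1, …, r_n)` of triangular arrays of size `n` with row sums
`r_1, …, r_n`; see `mem_H`. -/
def H {n : ℕ} (r : Fin n → ℕ) : Finset (TriangularArray n) :=
  Fintype.piFinset fun k => Finset.piAntidiag Finset.univ (r k)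

theorem mem_H {n : ℕ} (r : Fin n → ℕ) (A : TriangularArray n) :
    A ∈ H r ↔ ∀ i : Fin n, A.h (i.val + 1) = r i := by
  have key : ∀ i : Fin n, A.h (i.val + 1) = ∑ j, A i j := by
    intro i
    have hi := i.isLt
    unfold TriangularArray.h
    rw [Finset.sum_fin_eq_sum_range]
    refine Finset.sum_bij' (fun j _ => j - 1) (fun j _ => j + 1) ?_ ?_ ?_ ?_ ?_
    · intro j hj; simp only [mem_Icc, mem_range] at *; omega
    · intro j hj; simp only [mem_Icc, mem_range] at *; omega
    · intro j hj; simp only [mem_Icc, mem_range] at *; omega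
    · intro j hj; simp only [mem_Icc, mem_range] at *; omega
    · intro j hj
      have hj' := Finset.mem_Icc.1 hj
      unfold TriangularArray.entry
      rw [dif_pos (by omega), dif_pos (by omega)]
      rfl
  simp [H, key]

/-- `y_k = x_0 + x_1 + ⋯ + x_k`. -/
def y (x : ℕ → ℝ) (k : ℕ) : ℝ := ∑ i ∈ range (k + 1), x i

/-- The weight `w_x(A)` of a triangular array. -/
def w {n : ℕ} (x : ℕ → ℝ) (A : TriangularArray n) : ℝ :=
  x 0 ^ n * ∏ k ∈ Icc 1 n,
    (Nat.multinomial (Icc 1 k) (fun j => A.entry (n - k + j) j) : ℝ) *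
      (x k ^ A.v k / y x k ^ (A.d k + 1))

/-- The sum of the weights `w_x(A)` over all `A ∈ H_m(r_1, …, r_m)`,
where `m` is the length of the list `r`. -/
def weightSum (x : ℕ → ℝ) (r : List ℕ) : ℝ := ∑ A ∈ H r.get, w x A

end HilbertGalton

end

namespace HilbertGalton

/-! ### Triangular arrays: peeling off the longest diagonal -/

section Arrays

/-! Write `W(r)` for the total weight of the arrays with row sums `r = (r_1, …, r_m)`. Everything
rests on one recurrence (`rowWeight_recurrence`): `y_m W(r) = ∑_k x_k W(r - e_k) + x_0 [r_1 = 0]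
W(r_2, …, r_m)`, terms with `r_k = 0` being absent from the sum. It has the shape of a balance
equation for the first `m` bins: a ball enters bin `k` at rate `x_k`, a new leftmost bin opens at
rate `x_0`. It holds because an array is its longest diagonal plus a smaller array, the weight
factors accordingly (`w_succ`), and the diagonal factor obeys Pascal's rule for multinomial
coefficients.

Summing the recurrence over the last row sum gives `∑_s W(γ, s) = W(γ)` (`hasSum_weightSum_append`).
Hence the two formulas for `π(γ, g)`, a finite difference and a tail, agree, and `π ≥ 0`.

For stationarity, a state of `ℓ` bins is left at total rate `y_{ℓ-1}`. A transition first removes a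
ball on the right and then adds one. Since `π(γ, g + 1) = π(γ, g) - W(γ, g)`, the total `π`-mass of
the states that become `b` on removing a ball telescopes to `π(b)` (`sum_removeBall_eq`). So the
inflow is again expressed by `π` and `W`, and balance becomes `statWeight_balance`, a difference of
instances of the recurrence. The same telescoping gives total mass one, by induction on `n`.

Irreducibility: rates `x_0` and `x_1` alone suffice to build any composition from right to left. All
entries of `exp Q` are then positive, which forces uniqueness. -/

theorem multinomial_eq_sum_update {α : Type*} [DecidableEq α] (s : Finset α) (f : α → ℕ)
    (hf : ∑ i ∈ s, f i ≠ 0) :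
    Nat.multinomial s f = ∑ k ∈ s,
      if f k = 0 then 0 else Nat.multinomial s (Function.update f k (f k - 1)) := by
  have hpos : 0 < ∏ i ∈ s, (f i).factorial := Finset.prod_pos fun i _ => Nat.factorial_pos _
  refine Nat.eq_of_mul_eq_mul_left hpos ?_
  rw [Nat.multinomial_spec, Finset.mul_sum]
  obtain ⟨N, hN⟩ : ∃ N, ∑ i ∈ s, f i = N + 1 := Nat.exists_eq_succ_of_ne_zero hf
  -- Multiplied by `∏ (f i)!`, the summand of `k` becomes `f k * N!`; these add up to `(N + 1) *
  -- N!`.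
  have key : ∀ k ∈ s, (∏ i ∈ s, (f i).factorial) *
      (if f k = 0 then 0 else Nat.multinomial s (Function.update f k (f k - 1))) =
      f k * N.factorial := by
    intro k hk
    split_ifs with h0
    · simp [h0]
    · have hs : ∑ i ∈ s, Function.update f k (f k - 1) i = N := by
        rw [Finset.sum_update_of_mem hk]
        have := Finset.add_sum_erase s f hk
        rw [Finset.sdiff_singleton_eq_erase]
        omega
      have hspec := Nat.multinomial_spec s (Function.update f k (f k - 1))
      rw [hs] at hspec
      rw [← hspec, ← mul_assoc, ← Finset.mul_prod_erase s _ hk,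
        ← Finset.mul_prod_erase s (fun i => (Function.update f k (f k - 1) i).factorial) hk,
        Function.update_self, ← mul_assoc, Nat.mul_factorial_pred h0]
      congr 2
      refine Finset.prod_congr rfl fun i hi => ?_
      rw [Function.update_of_ne (Finset.ne_of_mem_erase hi)]
  rw [Finset.sum_congr rfl key, ← Finset.sum_mul, hN, Nat.factorial_succ]

/-- The law of the numbers of balls falling into the first `m` bins between two shifts. -/
noncomputable def shiftLaw {m : ℕ} (x : ℕ → ℝ) (a : Fin m → ℕ) : ℝ :=
  x 0 * (Nat.multinomial univ a * (∏ k : Fin m, x (k + 1) ^ a k) / y x m ^ (∑ k, a k + 1))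

/-- Pascal's rule: classify the words with letter counts `a` by their last letter `k`. Removing that
letter costs one factor `x_k / y_m`; only the empty word has no last letter, whence the source term
`x_0`. -/
theorem shiftLaw_recurrence {m : ℕ} (x : ℕ → ℝ) (hy : y x m ≠ 0) (a : Fin m → ℕ) :
    y x m * shiftLaw x a =
      ∑ k, (if a k = 0 then 0 else x (k + 1) * shiftLaw x (Function.update a k (a k - 1))) +
        if a = 0 then x 0 else 0 := by
  by_cases ha : a = 0
  · subst ha
    simp [shiftLaw, Nat.multinomial]
    field_simp
  · have hsum : ∑ i, a i ≠ 0 := by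
      intro h
      apply ha
      funext i
      simpa using (Finset.sum_eq_zero_iff.1 h) i (mem_univ i)
    rw [if_neg ha, add_zero]
    have key : ∀ k, (if a k = 0 then 0 else
        x (k + 1) * shiftLaw x (Function.update a k (a k - 1))) =
        x 0 * ((∏ k : Fin m, x (k + 1) ^ a k) / y x m ^ (∑ k, a k)) *
        (if a k = 0 then 0 else Nat.multinomial univ (Function.update a k (a k - 1)) : ℕ) := by
      intro k
      split_ifs with h0
      · simp
      · have hs : ∑ i, Function.update a k (a k - 1) i + 1 = ∑ i, a i := by
          rw [Finset.sum_update_of_mem (mem_univ k)]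
          have := Finset.add_sum_erase univ a (mem_univ k)
          rw [Finset.sdiff_singleton_eq_erase]
          omega
        have hp : x (k + 1) * ∏ i : Fin m, x (i + 1) ^ (Function.update a k (a k - 1) i) =
            ∏ i : Fin m, x (i + 1) ^ a i := by
          rw [← Finset.mul_prod_erase univ _ (mem_univ k),
            ← Finset.mul_prod_erase univ (fun i : Fin m => x (i + 1) ^ a i) (mem_univ k),
            Function.update_self, ← mul_assoc, mul_pow_sub_one h0]
          congr 1
          refine Finset.prod_congr rfl fun i hi => ?_
          rw [Function.update_of_ne (Finset.ne_of_mem_erase hi)]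
        rw [shiftLaw, hs, ← hp]
        ring
    rw [Finset.sum_congr rfl fun k _ => key k, ← Finset.mul_sum, ← Nat.cast_sum,
      ← multinomial_eq_sum_update univ a hsum, shiftLaw, pow_succ]
    field_simp

/-- The convolution of two functions of `m` natural numbers. -/
def conv {m : ℕ} (P G : (Fin m → ℕ) → ℝ) (r : Fin m → ℕ) : ℝ := ∑ a ∈ Iic r, P a * G (r - a)

theorem sum_Iic_update {m : ℕ} (P G : (Fin m → ℕ) → ℝ) (r : Fin m → ℕ) (k : Fin m) :
    ∑ a ∈ Iic r, (if a k = 0 then 0 else P (Function.update a k (a k - 1)) * G (r - a)) =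
      if r k = 0 then 0 else conv P G (Function.update r k (r k - 1)) := by
  split_ifs with h0
  · refine Finset.sum_eq_zero fun a ha => ?_
    have : a k ≤ r k := Finset.mem_Iic.1 ha k
    rw [if_pos (by omega)]
  · rw [Finset.sum_congr rfl (fun a _ => (ite_not _ _ _).symm),
      ← Finset.sum_filter, conv]
    refine Finset.sum_bij' (fun a _ => Function.update a k (a k - 1))
      (fun a _ => Function.update a k (a k + 1)) ?_ ?_ ?_ ?_ ?_
    · intro a ha
      simp only [mem_filter, mem_Iic, Pi.le_def] at ha ⊢
      intro i
      have := ha.1 i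
      by_cases hi : i = k
      · subst hi; simp; omega
      · simpa [hi] using this
    · intro a ha
      simp only [mem_filter, mem_Iic, Pi.le_def] at ha ⊢
      refine ⟨fun i => ?_, by simp⟩
      have := ha i
      by_cases hi : i = k
      · subst hi; simp at this ⊢; omega
      · simpa [hi] using this
    · intro a ha
      simp only [mem_filter] at ha
      simp [Nat.sub_add_cancel (Nat.pos_of_ne_zero ha.2)]
    · intro a ha
      simp
    · intro a ha
      simp only [mem_filter] at ha
      congr 2
      funext i
      by_cases hi : i = k
      · subst hi; simp; omega
      · simp [hi]

/-- Lowering a coordinate commutes with convolution (`sum_Iic_update`), so a linear recurrence for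
`P` passes to `P * G`; the source `b` at the origin turns into `b * G`. -/
theorem conv_recurrence {m : ℕ} (P G : (Fin m → ℕ) → ℝ) (c b : ℝ) (z : Fin m → ℝ)
    (hP : ∀ a, c * P a = ∑ k, (if a k = 0 then 0 else
      z k * P (Function.update a k (a k - 1))) + if a = 0 then b else 0) (r : Fin m → ℕ) :
    c * conv P G r =
      ∑ k, (if r k = 0 then 0 else z k * conv P G (Function.update r k (r k - 1))) + b * G r := by
  have h1 : ∀ k, (if r k = 0 then 0 else z k * conv P G (Function.update r k (r k - 1))) =
      ∑ a ∈ Iic r, (if a k = 0 then 0 else z k * P (Function.update a k (a k - 1))) * G (r - a) := by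
    intro k
    have := congrArg (z k * ·) (sum_Iic_update P G r k)
    simp only [mul_ite, mul_zero] at this
    rw [← this, Finset.mul_sum]
    refine Finset.sum_congr rfl fun a _ => ?_
    split_ifs <;> ring
  have h2 : b * G r = ∑ a ∈ Iic r, (if a = 0 then b else 0) * G (r - a) := by
    rw [Finset.sum_eq_single 0]
    · simp
    · intro a _ ha; simp [ha]
    · intro h; exact absurd (Finset.mem_Iic.2 zero_le) h
  rw [Finset.sum_congr rfl fun k _ => h1 k, Finset.sum_comm, h2, ← Finset.sum_add_distrib, conv,
    Finset.mul_sum]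
  refine Finset.sum_congr rfl fun a _ => ?_
  rw [← mul_assoc, hP, add_mul, Finset.sum_mul]

/-- A triangular array of size `m + 1` is its longest diagonal together with a triangular array
of size `m`. -/
def diagEquiv (m : ℕ) : TriangularArray (m + 1) ≃ (Fin (m + 1) → ℕ) × TriangularArray m where
  toFun A := (fun k => A k (Fin.last k), fun k j => A k.succ j.castSucc)
  invFun p := fun k j => if h : j.val = k.val then p.1 k else
    p.2 ⟨k - 1, by omega⟩ ⟨j, by simp only; omega⟩
  left_inv A := by
    funext k j
    dsimp only
    split_ifs with h
    · congr 1; exact Fin.ext h.symm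
    · obtain ⟨k, hk⟩ := k
      obtain ⟨j, hj⟩ := j
      cases k with
      | zero => simp at h hj; omega
      | succ k => rfl
  right_inv p := by
    refine Prod.ext ?_ ?_
    · funext k; simp
    · funext k j
      have := j.isLt
      simp only [Fin.val_castSucc, Fin.val_succ]
      rw [dif_neg (by omega)]
      rfl

theorem mem_H_iff {m : ℕ} (r : Fin m → ℕ) (A : TriangularArray m) :
    A ∈ H r ↔ ∀ k, ∑ j, A k j = r k := by
  simp [H]

/-- The first row has a single entry, which lies on the longest diagonal; it must therefore use up
`r 0` entirely. The other rows leave `r - a` to the smaller array. -/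
theorem mem_H_succ_iff {m : ℕ} (r : Fin (m + 1) → ℕ) (A : TriangularArray (m + 1)) :
    A ∈ H r ↔ ((diagEquiv m A).1 ∈ Iic r ∧ (diagEquiv m A).1 0 = r 0) ∧
      (diagEquiv m A).2 ∈ H (fun k => (r - (diagEquiv m A).1) k.succ) := by
  simp only [mem_H_iff, mem_Iic, Pi.le_def, Fin.forall_fin_succ, Pi.sub_apply]
  have hr : ∀ k : Fin m, ∑ j, A k.succ j = ∑ j, (diagEquiv m A).2 k j + (diagEquiv m A).1 k.succ :=
    fun k => Fin.sum_univ_castSucc (n := k + 1) (fun j => A k.succ j)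
  have h0 : ∑ j, A 0 j = (diagEquiv m A).1 0 := Fin.sum_univ_one (fun j : Fin 1 => A 0 j)
  simp only [hr, h0]
  constructor
  · rintro ⟨h1, h2⟩
    refine ⟨⟨⟨h1.le, fun i => ?_⟩, h1⟩, fun i => ?_⟩ <;> have := h2 i <;> omega
  · rintro ⟨⟨⟨h1, h2⟩, h3⟩, h4⟩
    refine ⟨h3, fun i => ?_⟩
    have := h2 i
    have := h4 i
    omega

theorem entry_diag {m : ℕ} (A : TriangularArray (m + 1)) (k : Fin (m + 1)) :
    A.entry (k + 1) (k + 1) = (diagEquiv m A).1 k := by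
  unfold TriangularArray.entry
  rw [dif_pos (by omega)]
  rfl

theorem entry_succ {m : ℕ} (A : TriangularArray (m + 1)) {i j : ℕ} (hj : 1 ≤ j) (hji : j ≤ i)
    (hi : i ≤ m) : A.entry (i + 1) j = (diagEquiv m A).2.entry i j := by
  unfold TriangularArray.entry
  rw [dif_pos (by omega), dif_pos (by omega)]
  obtain ⟨i, rfl⟩ : ∃ i', i = i' + 1 := ⟨i - 1, by omega⟩
  rfl

theorem sum_Icc_one_eq_univ {M : Type*} [AddCommMonoid M] (m : ℕ) (f : ℕ → M) :
    ∑ i ∈ Icc 1 m, f i = ∑ k : Fin m, f (k + 1) := by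
  rw [Fin.sum_univ_eq_sum_range (fun k => f (k + 1)), Finset.range_eq_Ico, Finset.sum_Ico_add' f]
  rfl

theorem prod_Icc_one_eq_univ {M : Type*} [CommMonoid M] (m : ℕ) (f : ℕ → M) :
    ∏ i ∈ Icc 1 m, f i = ∏ k : Fin m, f (k + 1) := by
  rw [Fin.prod_univ_eq_prod_range (fun k => f (k + 1)), Finset.range_eq_Ico, Finset.prod_Ico_add' f]
  rfl

/-- Diagonals are numbered by length, so peeling off the longest leaves every other `d_k` unchanged,
while each `v_k` loses exactly the entry `A_{k,k}`. -/
theorem w_succ {m : ℕ} (x : ℕ → ℝ) (A : TriangularArray (m + 1)) :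
    w x A = shiftLaw x (diagEquiv m A).1 * w x (diagEquiv m A).2 := by
  have hd : A.d (m + 1) = ∑ k, (diagEquiv m A).1 k := by
    simp only [TriangularArray.d, Nat.sub_self, zero_add]
    rw [sum_Icc_one_eq_univ]
    exact Finset.sum_congr rfl fun k _ => entry_diag A k
  have hd' : ∀ k ∈ Icc 1 m, A.d k = (diagEquiv m A).2.d k := by
    intro k hk
    rw [mem_Icc] at hk
    refine Finset.sum_congr rfl fun j hj => ?_
    rw [mem_Icc] at hj
    rw [← entry_succ A hj.1 (by omega) (by omega)]
    congr 1; omega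
  have hmult : Nat.multinomial (Icc 1 (m + 1)) (fun j => A.entry (m + 1 - (m + 1) + j) j) =
      Nat.multinomial univ (diagEquiv m A).1 := by
    simp only [Nat.multinomial, Nat.sub_self, zero_add]
    rw [sum_Icc_one_eq_univ, prod_Icc_one_eq_univ]
    simp only [entry_diag]
  have hmult' : ∀ k ∈ Icc 1 m, Nat.multinomial (Icc 1 k) (fun j => A.entry (m + 1 - k + j) j) =
      Nat.multinomial (Icc 1 k) (fun j => (diagEquiv m A).2.entry (m - k + j) j) := by
    intro k hk
    rw [mem_Icc] at hk
    refine Nat.multinomial_congr fun j hj => ?_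
    rw [mem_Icc] at hj
    rw [← entry_succ A hj.1 (by omega) (by omega)]
    congr 1; omega
  have hv : A.v (m + 1) = A.entry (m + 1) (m + 1) := by
    simp [TriangularArray.v]
  have hv' : ∀ k ∈ Icc 1 m, A.v k = A.entry k k + (diagEquiv m A).2.v k := by
    intro k hk
    rw [mem_Icc] at hk
    unfold TriangularArray.v
    rw [← Finset.add_sum_Ioc_eq_sum_Icc (by omega)]
    congr 1
    rw [show Ioc k (m + 1) = Ico (k + 1) (m + 1 + 1) by ext; simp only [mem_Ioc, mem_Ico]; omega,
      ← Finset.sum_Ico_add' (fun i => A.entry i k) k (m + 1) 1]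
    refine Finset.sum_congr rfl fun i hi => ?_
    rw [mem_Icc] at hi
    exact entry_succ A hk.1 hi.1 hi.2
  have hx : ∏ k : Fin (m + 1), x (k + 1) ^ (diagEquiv m A).1 k =
      (∏ k ∈ Icc 1 m, x k ^ A.entry k k) * x (m + 1) ^ A.entry (m + 1) (m + 1) := by
    rw [← Finset.prod_Icc_succ_top (by omega) (fun k => x k ^ A.entry k k), prod_Icc_one_eq_univ]
    simp only [entry_diag]
  rw [w, Finset.prod_Icc_succ_top (by omega), hmult, hd, hv, shiftLaw, hx, w]
  have : ∀ k ∈ Icc 1 m, (Nat.multinomial (Icc 1 k) (fun j => A.entry (m + 1 - k + j) j) : ℝ) *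
      (x k ^ A.v k / y x k ^ (A.d k + 1)) = x k ^ A.entry k k *
      ((Nat.multinomial (Icc 1 k) (fun j => (diagEquiv m A).2.entry (m - k + j) j) : ℝ) *
      (x k ^ (diagEquiv m A).2.v k / y x k ^ ((diagEquiv m A).2.d k + 1))) := by
    intro k hk
    rw [hmult' k hk, hd' k hk, hv' k hk, pow_add]
    ring
  rw [Finset.prod_congr rfl this, Finset.prod_mul_distrib, pow_succ]
  ring

/-- The sum of the weights of the arrays with row sums `r`. -/
noncomputable def rowWeight {m : ℕ} (x : ℕ → ℝ) (r : Fin m → ℕ) : ℝ := ∑ A ∈ H r, w x A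

theorem rowWeight_succ {m : ℕ} (x : ℕ → ℝ) (r : Fin (m + 1) → ℕ) :
    rowWeight x r = conv (shiftLaw x)
      (fun u => if u 0 = 0 then rowWeight x (fun k => u k.succ) else 0) r := by
  have h1 : ∀ a ∈ Iic r, shiftLaw x a * (if (r - a) 0 = 0 then
      rowWeight x (fun k => (r - a) k.succ) else 0) =
      if a 0 = r 0 then ∑ B ∈ H (fun k => (r - a) k.succ), shiftLaw x a * w x B else 0 := by
    intro a ha
    have : a 0 ≤ r 0 := Finset.mem_Iic.1 ha 0
    have hiff : (r - a) 0 = 0 ↔ a 0 = r 0 := by rw [Pi.sub_apply]; omega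
    simp only [hiff, rowWeight, mul_ite, mul_zero, Finset.mul_sum]
  rw [conv, Finset.sum_congr rfl h1, ← Finset.sum_filter, Finset.sum_sigma']
  refine Finset.sum_bij' (fun A _ => ⟨(diagEquiv m A).1, (diagEquiv m A).2⟩)
    (fun p _ => (diagEquiv m).symm (p.1, p.2)) ?_ ?_ ?_ ?_ ?_
  · intro A hA
    rw [mem_H_succ_iff] at hA
    simpa only [mem_sigma, mem_filter] using hA
  · intro p hp
    rw [mem_H_succ_iff]
    simpa only [mem_sigma, mem_filter, Equiv.apply_symm_apply] using hp
  · intro A _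
    simp
  · intro p _
    simp
  · intro A _
    exact w_succ x A

/-- The recurrence of the diagonal factor, transported through the convolution `rowWeight_succ`. -/
theorem rowWeight_recurrence {m : ℕ} (x : ℕ → ℝ) (hy : y x (m + 1) ≠ 0) (r : Fin (m + 1) → ℕ) :
    y x (m + 1) * rowWeight x r =
      ∑ k, (if r k = 0 then 0 else x (k + 1) * rowWeight x (Function.update r k (r k - 1))) +
        x 0 * if r 0 = 0 then rowWeight x (fun k => r k.succ) else 0 := by
  simp only [rowWeight_succ x (m := m)]
  exact conv_recurrence _ _ _ _ (fun k => x (k + 1)) (shiftLaw_recurrence x hy) r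

theorem weightSum_eq {m : ℕ} (x : ℕ → ℝ) (l : List ℕ) (r : Fin m → ℕ) (hl : l.length = m)
    (h : ∀ i (hi : i < m), l[i] = r ⟨i, hi⟩) : weightSum x l = rowWeight x r := by
  subst hl
  have : l.get = r := funext fun i => h i i.isLt
  rw [weightSum, this, rowWeight]

theorem weightSum_nil (x : ℕ → ℝ) : weightSum x [] = 1 := by
  have : H ([] : List ℕ).get = {fun k => k.elim0} := by
    ext A
    simp only [mem_H_iff, mem_singleton]
    exact ⟨fun _ => funext fun k => k.elim0, fun _ k => k.elim0⟩
  rw [weightSum, this]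
  simp [w]

theorem weightSum_nonneg (x : ℕ → ℝ) (l : List ℕ) (hx : ∀ i ≤ l.length, 0 ≤ x i) :
    0 ≤ weightSum x l := by
  refine Finset.sum_nonneg fun A _ => mul_nonneg (pow_nonneg (hx 0 zero_le) _)
    (Finset.prod_nonneg fun k hk => ?_)
  rw [mem_Icc] at hk
  have hy : 0 ≤ y x k := Finset.sum_nonneg fun i hi => hx i (by rw [mem_range] at hi; omega)
  have := hx k hk.2
  positivity

/-- The value at `t` if the list is `0 :: t`, and `0` otherwise. -/
def shiftTerm (F : List ℕ → ℝ) : List ℕ → ℝ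
  | 0 :: t => F t
  | _ => 0

theorem weightSum_recurrence (x : ℕ → ℝ) (l : List ℕ) (h0 : l ≠ []) (hy : y x l.length ≠ 0) :
    y x l.length * weightSum x l =
      ∑ k ∈ range l.length, (if l.getD k 0 = 0 then 0 else
        x (k + 1) * weightSum x (l.modify k (· - 1))) + x 0 * shiftTerm (weightSum x) l := by
  obtain ⟨b, t, rfl⟩ := List.exists_cons_of_ne_nil h0
  have hrec := rowWeight_recurrence (m := t.length) x hy (b :: t).get
  rw [weightSum_eq x (b :: t) (b :: t).get rfl (fun _ _ => rfl),
    ← Fin.sum_univ_eq_sum_range (fun k => if (b :: t).getD k 0 = 0 then 0 else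
        x (k + 1) * weightSum x ((b :: t).modify k (· - 1)))]
  refine hrec.trans ?_
  congr 1
  · refine Finset.sum_congr rfl fun k _ => ?_
    have hk : (b :: t).get k = (b :: t).getD k 0 := by
      rw [List.getD_eq_getElem _ _ k.isLt]; rfl
    rw [hk]
    split_ifs with h
    · rfl
    · congr 1
      symm
      refine weightSum_eq x _ _ (by simp) fun i hi => ?_
      rw [List.getElem_modify]
      by_cases hik : k = ⟨i, hi⟩
      · subst hik
        rw [if_pos rfl, Function.update_self, List.getD_eq_getElem _ _ hi]
      · rw [Function.update_of_ne (Ne.symm hik), if_neg (fun h => hik (Fin.ext h))]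
        rfl
  · congr 1
    cases b with
    | zero => exact (if_pos rfl).trans (weightSum_eq x t _ rfl (fun _ _ => rfl)).symm
    | succ b => exact if_neg (Nat.succ_ne_zero b)

end Arrays
-- Summing out the last row sum
section Marginals

theorem modify_append_of_lt {α : Type*} (f : α → α) (l₁ l₂ : List α) (k : ℕ)
    (hk : k < l₁.length) : (l₁ ++ l₂).modify k f = l₁.modify k f ++ l₂ := by
  induction l₁ generalizing k with
  | nil => simp at hk
  | cons a l₁ ih =>
    cases k with
    | zero => simp
    | succ k => simpa using ih k (by simpa using hk)

theorem modify_append_length {α : Type*} (f : α → α) (l : List α) (a : α) :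
    (l ++ [a]).modify l.length f = l ++ [f a] := by
  induction l with
  | nil => simp
  | cons b l ih => simpa using ih

theorem sum_modify_pred (l : List ℕ) (k : ℕ) (hk : l.getD k 0 ≠ 0) :
    (l.modify k (· - 1)).sum + 1 = l.sum := by
  induction l generalizing k with
  | nil => simp at hk
  | cons a l ih =>
    cases k with
    | zero => simp at hk ⊢; omega
    | succ k =>
      have := ih k (by simpa using hk)
      simp only [List.modify_succ_cons, List.sum_cons]
      omega

/-- Summing over `s` gives `c A = q A + B`. The same identity for partial sums, with `q < c` and
nonnegative terms, bounds them by `B / (c - q)` and so yields convergence. -/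
theorem hasSum_of_recurrence {a b : ℕ → ℝ} {c q B : ℝ} (ha : ∀ s, 0 ≤ a s) (hb : ∀ s, 0 ≤ b s)
    (hq : 0 ≤ q) (hqc : q < c) (hB : HasSum b B)
    (h : ∀ s, c * a s = (if s = 0 then 0 else q * a (s - 1)) + b s) :
    HasSum a (B / (c - q)) := by
  have hcq : 0 < c - q := sub_pos.2 hqc
  have hpart : ∀ N, c * ∑ s ∈ range (N + 1), a s =
      q * ∑ s ∈ range N, a s + ∑ s ∈ range (N + 1), b s := by
    intro N
    rw [Finset.mul_sum, Finset.sum_congr rfl fun s _ => h s, Finset.sum_add_distrib,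
      Finset.sum_range_succ' (fun s => if s = 0 then 0 else q * a (s - 1))]
    simp [Finset.mul_sum]
  have hsum : Summable a := by
    refine summable_of_sum_range_le (c := B / (c - q)) ha fun N => ?_
    rw [le_div_iff₀ hcq]
    have h1 := hpart N
    have h2 : ∑ s ∈ range (N + 1), b s ≤ B := sum_le_hasSum _ (fun i _ => hb i) hB
    rw [Finset.sum_range_succ a] at h1
    have h3 : 0 ≤ (c - q) * a N := mul_nonneg hcq.le (ha N)
    have h4 : 0 ≤ q * a N := mul_nonneg hq (ha N)
    nlinarith
  have hA := hsum.hasSum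
  have h1 : HasSum (fun s => if s = 0 then 0 else q * a (s - 1)) (q * ∑' s, a s) := by
    rw [← hasSum_nat_add_iff' 1]
    simpa using hA.mul_left q
  have h2 := (h1.add hB).unique (by simpa only [h] using hA.mul_left c)
  have h3 : ∑' s, a s = B / (c - q) := by
    rw [eq_div_iff hcq.ne']
    linarith
  exact h3 ▸ hA

variable {n : ℕ} {x : ℕ → ℝ}

theorem y_pos (hx : ∀ i ≤ n, 0 ≤ x i) (hx0 : 0 < x 0) {k : ℕ} (hk : k ≤ n) : 0 < y x k :=
  Finset.sum_pos' (fun i hi => hx i (by rw [mem_range] at hi; omega)) ⟨0, by simp, hx0⟩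

theorem y_succ (x : ℕ → ℝ) (k : ℕ) : y x (k + 1) = y x k + x (k + 1) :=
  Finset.sum_range_succ _ _

theorem weightSum_append_recurrence (hx : ∀ i ≤ n, 0 ≤ x i) (hx0 : 0 < x 0) (γ : List ℕ) (s : ℕ)
    (hγ : γ.length < n) :
    y x (γ.length + 1) * weightSum x (γ ++ [s]) =
      ∑ k ∈ range γ.length, (if γ.getD k 0 = 0 then 0 else
        x (k + 1) * weightSum x (γ.modify k (· - 1) ++ [s])) +
      (if s = 0 then 0 else x (γ.length + 1) * weightSum x (γ ++ [s - 1])) +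
      x 0 * shiftTerm (weightSum x) (γ ++ [s]) := by
  have hlen : (γ ++ [s]).length = γ.length + 1 := by simp
  have := weightSum_recurrence x (γ ++ [s]) (by simp) (by
    rw [hlen]; exact (y_pos hx hx0 hγ).ne')
  rw [hlen, Finset.sum_range_succ] at this
  rw [this]
  congr 2
  · refine Finset.sum_congr rfl fun k hk => ?_
    rw [mem_range] at hk
    rw [List.getD_append _ _ _ _ hk, modify_append_of_lt _ _ _ _ hk]
  · rw [List.getD_append_right _ _ _ _ le_rfl, modify_append_length]
    simp

/-- As a recurrence in `s`, the one for `γ ++ [s]` has constants `y_{m+1}` and `x_{m+1}`, where `m`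
is the length of `γ`; their difference is `y_m`. By induction the remaining terms sum to the
right-hand side of the recurrence for `γ`, that is, to `y_m W(γ)`. Lowering a part decreases the sum
of `γ`, dropping a leading zero decreases its length, hence the induction on length plus sum. -/
theorem hasSum_weightSum_append (hx : ∀ i ≤ n, 0 ≤ x i) (hx0 : 0 < x 0) (γ : List ℕ)
    (hγ : γ.length < n) : HasSum (fun s => weightSum x (γ ++ [s])) (weightSum x γ) := by
  induction hN : γ.length + γ.sum using Nat.strong_induction_on generalizing γ with
  | _ N ih =>
    have hnn : ∀ l : List ℕ, l.length ≤ n → 0 ≤ weightSum x l := fun l hl =>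
      weightSum_nonneg x l fun i hi => hx i (hi.trans hl)
    set b : ℕ → ℝ := fun s => ∑ k ∈ range γ.length, (if γ.getD k 0 = 0 then 0 else
        x (k + 1) * weightSum x (γ.modify k (· - 1) ++ [s])) +
        x 0 * shiftTerm (weightSum x) (γ ++ [s]) with hbdef
    have hb0 : ∀ s, 0 ≤ b s := by
      intro s
      refine add_nonneg (Finset.sum_nonneg fun k hk => ?_) (mul_nonneg hx0.le ?_)
      · rw [mem_range] at hk
        split_ifs
        · exact le_rfl
        · exact mul_nonneg (hx _ (by omega)) (hnn _ (by simp; omega))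
      · unfold shiftTerm
        split
        · rename_i t ht
          have := congrArg List.length ht
          simp at this
          exact hnn _ (by omega)
        · exact le_rfl
    have hmod : ∀ k < γ.length, γ.getD k 0 ≠ 0 →
        HasSum (fun s => weightSum x (γ.modify k (· - 1) ++ [s]))
          (weightSum x (γ.modify k (· - 1))) := by
      intro k hk h0
      refine ih _ ?_ _ (by simpa using hγ) rfl
      have : (γ.modify k (· - 1)).sum + 1 = γ.sum := sum_modify_pred γ k h0
      simp only [List.length_modify]
      omega
    have hB : HasSum b (y x γ.length * weightSum x γ) := by
      have h1 : HasSum (fun s => ∑ k ∈ range γ.length, (if γ.getD k 0 = 0 then 0 else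
          x (k + 1) * weightSum x (γ.modify k (· - 1) ++ [s])))
          (∑ k ∈ range γ.length, (if γ.getD k 0 = 0 then 0 else
            x (k + 1) * weightSum x (γ.modify k (· - 1)))) := by
        refine hasSum_sum fun k hk => ?_
        rw [mem_range] at hk
        split_ifs with h0
        · exact hasSum_zero
        · exact (hmod k hk h0).mul_left _
      -- For empty `γ` the recurrence for `γ` is unavailable: the shift term contributes only at `s
      -- = 0`, and `y_0 = x_0`.
      rcases γ with _ | ⟨_ | g, t⟩
      · have h2 : HasSum (fun s => shiftTerm (weightSum x) ([] ++ [s])) 1 := by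
          convert hasSum_ite_eq (0 : ℕ) (1 : ℝ) using 2 with s
          cases s <;> simp [shiftTerm, weightSum_nil]
        convert h1.add (h2.mul_left (x 0)) using 1
        simp [weightSum_nil, y]
      · have h2 : HasSum (fun s => weightSum x (t ++ [s])) (weightSum x t) :=
          ih _ (by subst hN; simp) _ (by simp at hγ; omega) rfl
        rw [weightSum_recurrence x _ (by simp) (y_pos hx hx0 hγ.le).ne']
        exact h1.add (h2.mul_left (x 0))
      · rw [weightSum_recurrence x _ (by simp) (y_pos hx hx0 hγ.le).ne']
        exact h1.add (hasSum_zero.mul_left (x 0))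
    have hlt : x (γ.length + 1) < y x (γ.length + 1) := by
      rw [y_succ]
      linarith [y_pos hx hx0 hγ.le]
    have := hasSum_of_recurrence (a := fun s => weightSum x (γ ++ [s]))
      (fun s => hnn _ (by simpa using hγ)) hb0 (hx _ hγ) hlt hB
      (fun s => by
        rw [weightSum_append_recurrence hx hx0 γ s hγ, hbdef]
        ring)
    rwa [y_succ, add_sub_cancel_right, mul_div_cancel_left₀ _ (y_pos hx hx0 hγ.le).ne'] at this

end Marginals

/-! ### Balance equations for the candidate weights -/

section Balance

variable {n : ℕ} {x : ℕ → ℝ}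

/-- The stationary weight of the composition whose parts are the elements of `l` plus one. -/
noncomputable def statWeight (x : ℕ → ℝ) (l : List ℕ) : ℝ :=
  weightSum x l.dropLast - ∑ s ∈ range (l.getLastD 0), weightSum x (l.dropLast ++ [s])

theorem statWeight_nil (x : ℕ → ℝ) : statWeight x [] = 1 := by
  simp [statWeight, weightSum_nil]

theorem statWeight_append (x : ℕ → ℝ) (γ : List ℕ) (g : ℕ) :
    statWeight x (γ ++ [g]) = weightSum x γ - ∑ s ∈ range g, weightSum x (γ ++ [s]) := by
  simp [statWeight]

theorem statWeight_append_zero (x : ℕ → ℝ) (γ : List ℕ) :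
    statWeight x (γ ++ [0]) = weightSum x γ := by
  simp [statWeight_append]

theorem statWeight_append_succ (x : ℕ → ℝ) (γ : List ℕ) (g : ℕ) :
    statWeight x (γ ++ [g + 1]) = statWeight x (γ ++ [g]) - weightSum x (γ ++ [g]) := by
  rw [statWeight_append, statWeight_append, Finset.sum_range_succ]
  ring

theorem hasSum_statWeight (hx : ∀ i ≤ n, 0 ≤ x i) (hx0 : 0 < x 0) (γ : List ℕ) (g : ℕ)
    (hγ : γ.length < n) :
    HasSum (fun s : Set.Ici g => weightSum x (γ ++ [(s : ℕ)])) (statWeight x (γ ++ [g])) := by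
  have h := hasSum_weightSum_append hx hx0 γ hγ
  rw [← sub_add_cancel (weightSum x γ) (∑ s ∈ range g, weightSum x (γ ++ [s])),
    ← statWeight_append, ← Finset.hasSum_compl_iff (range g)] at h
  have hs : (Set.Ici g : Set ℕ) = {s | s ∉ range g} := by ext; simp
  rw [hs]
  exact h

theorem statWeight_nonneg (hx : ∀ i ≤ n, 0 ≤ x i) (hx0 : 0 < x 0) (l : List ℕ)
    (hl : l.length ≤ n) : 0 ≤ statWeight x l := by
  rcases List.eq_nil_or_concat l with rfl | ⟨γ, g, rfl⟩
  · simp [statWeight_nil]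
  · rw [List.concat_eq_append] at hl ⊢
    refine (hasSum_statWeight hx hx0 γ g (by simpa using hl)).nonneg fun s => ?_
    exact weightSum_nonneg x _ fun i hi => hx i (hi.trans (by simpa using hl))

theorem shiftTerm_statWeight_zero (x : ℕ → ℝ) (γ : List ℕ) (h : γ ≠ []) :
    shiftTerm (statWeight x) (γ ++ [0]) = shiftTerm (weightSum x) γ := by
  rcases γ with _ | ⟨_ | g, t⟩
  · exact absurd rfl h
  · exact statWeight_append_zero x t
  · rfl

theorem shiftTerm_statWeight_succ (x : ℕ → ℝ) (γ : List ℕ) (g : ℕ) :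
    shiftTerm (statWeight x) (γ ++ [g + 1]) =
      shiftTerm (statWeight x) (γ ++ [g]) - shiftTerm (weightSum x) (γ ++ [g]) := by
  rcases γ with _ | ⟨_ | b, t⟩
  · cases g <;> simp [shiftTerm, statWeight_nil, weightSum_nil]
  · exact statWeight_append_succ x t g
  · simp [shiftTerm]

/-- Induction on `g`. At `g = 0` this is the recurrence for `γ`; passing to `g + 1` subtracts the
recurrence for `γ ++ [g]`, whose factor `y_{m+1} = y_m + x_{m+1}`, with `m` the length of `γ`,
supplies the new last-bin term. -/
theorem statWeight_append_balance (hx : ∀ i ≤ n, 0 ≤ x i) (hx0 : 0 < x 0) (γ : List ℕ) (g : ℕ)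
    (hγ : γ.length < n) :
    y x γ.length * statWeight x (γ ++ [g]) =
      ∑ k ∈ range γ.length, (if γ.getD k 0 = 0 then 0 else
        x (k + 1) * statWeight x (γ.modify k (· - 1) ++ [g])) +
      (if g = 0 then 0 else x (γ.length + 1) * weightSum x (γ ++ [g - 1])) +
      x 0 * shiftTerm (statWeight x) (γ ++ [g]) := by
  induction g with
  | zero =>
    simp only [statWeight_append_zero, if_true, add_zero]
    by_cases h : γ = []
    · subst h
      simp [shiftTerm, statWeight_nil, weightSum_nil, y]
    · rw [shiftTerm_statWeight_zero x γ h]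
      exact weightSum_recurrence x γ h (y_pos hx hx0 hγ.le).ne'
  | succ g ih =>
    have hrec := weightSum_append_recurrence hx hx0 γ g hγ
    rw [y_succ] at hrec
    simp only [statWeight_append_succ, shiftTerm_statWeight_succ, Nat.add_sub_cancel,
      Nat.succ_ne_zero, if_false]
    have hsum : ∑ k ∈ range γ.length, (if γ.getD k 0 = 0 then 0 else
        x (k + 1) * (statWeight x (γ.modify k (· - 1) ++ [g]) -
          weightSum x (γ.modify k (· - 1) ++ [g]))) =
        ∑ k ∈ range γ.length, (if γ.getD k 0 = 0 then 0 else
        x (k + 1) * statWeight x (γ.modify k (· - 1) ++ [g])) -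
        ∑ k ∈ range γ.length, (if γ.getD k 0 = 0 then 0 else
        x (k + 1) * weightSum x (γ.modify k (· - 1) ++ [g])) := by
      rw [← Finset.sum_sub_distrib]
      refine Finset.sum_congr rfl fun k _ => ?_
      split_ifs <;> ring
    rw [hsum]
    linear_combination ih - hrec

/-- The shape to be matched with the inflow of the chain: one term per bin receiving the ball, with
`weightSum` in place of `statWeight` for the last bin. -/
theorem statWeight_balance (hx : ∀ i ≤ n, 0 ≤ x i) (hx0 : 0 < x 0) (l : List ℕ) (h0 : l ≠ [])
    (hl : l.length ≤ n) :
    y x (l.length - 1) * statWeight x l =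
      x 0 * shiftTerm (statWeight x) l +
      ∑ k ∈ range l.length, x (k + 1) * (if l.getD k 0 = 0 then 0 else
        if k + 1 < l.length then statWeight x (l.modify k (· - 1))
        else weightSum x (l.modify k (· - 1))) := by
  obtain ⟨γ, g, rfl⟩ : ∃ γ g, l = γ ++ [g] :=
    ⟨l.dropLast, l.getLast h0, (List.dropLast_append_getLast h0).symm⟩
  rw [List.length_append, List.length_singleton] at *
  rw [Nat.add_sub_cancel, statWeight_append_balance hx hx0 γ g hl, add_comm,
    Finset.sum_range_succ]
  congr 2
  · refine Finset.sum_congr rfl fun k hk => ?_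
    rw [mem_range] at hk
    rw [List.getD_append _ _ _ _ hk, modify_append_of_lt _ _ _ _ hk,
      if_pos (show k + 1 < γ.length + 1 by omega), mul_ite, mul_zero]
  · rw [List.getD_append_right _ _ _ _ le_rfl, modify_append_length]
    simp

end Balance
-- Finite chains: positivity of transition probabilities and uniqueness
section ChainTheory

variable {S : Type*}

/-- The positive part satisfies `d⁺ ≤ d⁺ M`, and both sides have the same total, so `d⁺` is
invariant. If nonzero it is positive everywhere because `M` is, contradicting total zero. Hence `d ≤
0`, and total zero gives `d = 0`. -/
theorem eq_zero_of_pos_invariant [Fintype S] {M : Matrix S S ℝ} (hM : ∀ c c', 0 < M c c')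
    (hrow : ∀ c, ∑ c', M c c' = 1) {d : S → ℝ} (hd : ∀ c', ∑ c, d c * M c c' = d c')
    (hsum : ∑ c, d c = 0) : d = 0 := by
  have hle : ∀ c', max (d c') 0 ≤ ∑ c, max (d c) 0 * M c c' := by
    intro c'
    refine max_le ?_ (Finset.sum_nonneg fun c _ => mul_nonneg (le_max_right _ _) (hM _ _).le)
    rw [← hd c']
    exact Finset.sum_le_sum fun c _ => mul_le_mul_of_nonneg_right (le_max_left _ _) (hM _ _).le
  have htot : ∑ c', max (d c') 0 = ∑ c', ∑ c, max (d c) 0 * M c c' := by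
    rw [Finset.sum_comm]
    simp only [← Finset.mul_sum, hrow, mul_one]
  have heq := (Finset.sum_eq_sum_iff_of_le fun c' _ => hle c').1 htot
  have hnonpos : ∀ c, d c ≤ 0 := by
    by_contra! hne
    obtain ⟨c₀, h₀⟩ := hne
    have hpos : ∀ c', 0 < d c' := by
      intro c'
      have : 0 < max (d c') 0 := by
        rw [heq c' (mem_univ _)]
        exact Finset.sum_pos' (fun c _ => mul_nonneg (le_max_right _ _) (hM _ _).le)
          ⟨c₀, mem_univ _, mul_pos (lt_max_of_lt_left h₀) (hM _ _)⟩
      simpa using this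
    have : 0 < ∑ c, d c := Finset.sum_pos (fun c _ => hpos c) ⟨c₀, mem_univ _⟩
    exact this.ne' hsum
  funext c
  exact (Finset.sum_eq_zero_iff_of_nonpos fun c _ => hnonpos c).1 hsum c (mem_univ c)

/-- The matrix of transition rates, including those of the transitions from a state to itself. -/
def rateMatrix [DecidableEq S] (m : ℕ) (x : ℕ → ℝ) (T : ℕ → S → S) : Matrix S S ℝ :=
  Matrix.of fun c c' => ∑ j ∈ range m, x j * (if T j c = c' then 1 else 0)

theorem generator_eq [DecidableEq S] (m : ℕ) (x : ℕ → ℝ) (T : ℕ → S → S) :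
    generator m x T = rateMatrix m x T + (-∑ j ∈ range m, x j) • (1 : Matrix S S ℝ) := by
  ext c c'
  simp only [generator, rateMatrix, Matrix.of_apply, Matrix.add_apply, Matrix.smul_apply,
    Matrix.one_apply, smul_eq_mul, mul_sub, Finset.sum_sub_distrib, neg_mul, Finset.sum_mul]
  ring

variable [Fintype S] [DecidableEq S]

open scoped Matrix.Norms.Operator in
theorem hasSum_exp_matrix (A : Matrix S S ℝ) :
    HasSum (fun k : ℕ => (k.factorial⁻¹ : ℝ) • A ^ k) (NormedSpace.exp A) :=
  NormedSpace.exp_series_hasSum_exp' A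

theorem hasSum_exp_apply (A : Matrix S S ℝ) (c c' : S) :
    HasSum (fun k : ℕ => (k.factorial⁻¹ : ℝ) * (A ^ k) c c') (NormedSpace.exp A c c') :=
  (Pi.hasSum.1 (Pi.hasSum.1 (hasSum_exp_matrix A) c)) c'

theorem vecMul_exp_of_vecMul_eq_zero (p : S → ℝ) (A : Matrix S S ℝ) (h : Matrix.vecMul p A = 0) :
    Matrix.vecMul p (NormedSpace.exp A) = p := by
  funext c'
  have h1 : HasSum (fun k : ℕ => ∑ c, p c * ((k.factorial⁻¹ : ℝ) * (A ^ k) c c'))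
      (∑ c, p c * NormedSpace.exp A c c') :=
    hasSum_sum fun c _ => (hasSum_exp_apply A c c').mul_left (p c)
  have h2 : ∀ k : ℕ, k ≠ 0 → ∑ c, p c * ((k.factorial⁻¹ : ℝ) * (A ^ k) c c') = 0 := by
    intro k hk
    obtain ⟨k, rfl⟩ := Nat.exists_eq_succ_of_ne_zero hk
    have h3 : Matrix.vecMul p (A ^ (k + 1)) c' = 0 := by
      rw [pow_succ', ← Matrix.vecMul_vecMul, h, Matrix.zero_vecMul]; rfl
    calc _ = ((k + 1).factorial⁻¹ : ℝ) * Matrix.vecMul p (A ^ (k + 1)) c' := by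
          simp only [Matrix.vecMul, dotProduct, Finset.mul_sum]
          exact Finset.sum_congr rfl fun c _ => by ring
      _ = 0 := by rw [h3, mul_zero]
  have h4 := h1.unique (hasSum_single 0 h2)
  refine h4.trans ?_
  simp [Matrix.one_apply]

/-- The constant vector is killed by the transpose of `A`, hence fixed by its exponential. -/
theorem sum_exp_apply_eq_one (A : Matrix S S ℝ) (h : ∀ c, ∑ c', A c c' = 0) (c : S) :
    ∑ c', NormedSpace.exp A c c' = 1 := by
  have h1 : Matrix.vecMul (fun _ => (1 : ℝ)) A.transpose = 0 := by
    funext c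
    simpa [Matrix.vecMul, dotProduct] using h c
  have h2 := congrFun (vecMul_exp_of_vecMul_eq_zero _ _ h1) c
  rw [Matrix.exp_transpose] at h2
  simpa [Matrix.vecMul, dotProduct] using h2

theorem generator_row_sum (m : ℕ) (x : ℕ → ℝ) (T : ℕ → S → S) (c : S) :
    ∑ c', generator m x T c c' = 0 := by
  simp only [generator, Matrix.of_apply]
  rw [Finset.sum_comm]
  refine Finset.sum_eq_zero fun j _ => ?_
  rw [← Finset.mul_sum, Finset.sum_sub_distrib]
  simp

theorem exp_smul_one (a : ℝ) :
    NormedSpace.exp (a • (1 : Matrix S S ℝ)) = Real.exp a • (1 : Matrix S S ℝ) := by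
  rw [Matrix.smul_one_eq_diagonal, Matrix.exp_diagonal, Matrix.smul_one_eq_diagonal]
  congr 1
  funext i
  rw [Pi.coe_exp, Real.exp_eq_exp_ℝ]

/-- The generator is a nonnegative matrix `R` minus a scalar `λ`, so `exp (tQ) = e^{-λt} exp (tR)`.
A path of length `k` makes the `k`-th term of the exponential series positive, and no term is
negative. -/
theorem transitionProb_pos {m : ℕ} {x : ℕ → ℝ} {T : ℕ → S → S} (hx : ∀ j < m, 0 ≤ x j) {c c' : S}
    (h : Relation.ReflTransGen (fun c c' => 0 < rateMatrix m x T c c') c c') {t : ℝ}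
    (ht : 0 < t) : 0 < transitionProb (generator m x T) t c c' := by
  have hnn : ∀ c c', 0 ≤ rateMatrix m x T c c' := fun c c' =>
    Finset.sum_nonneg fun j hj => mul_nonneg (hx j (mem_range.1 hj)) (by split_ifs <;> norm_num)
  have hpow : ∀ k : ℕ, ∀ c c', 0 ≤ (rateMatrix m x T ^ k) c c' := by
    intro k
    induction k with
    | zero => intro c c'; rw [pow_zero, Matrix.one_apply]; split_ifs <;> norm_num
    | succ k ih =>
      intro c c'
      rw [pow_succ, Matrix.mul_apply]
      exact Finset.sum_nonneg fun d _ => mul_nonneg (ih _ _) (hnn _ _)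
  obtain ⟨k, hk⟩ : ∃ k : ℕ, 0 < (rateMatrix m x T ^ k) c c' := by
    induction h with
    | refl => exact ⟨0, by simp⟩
    | @tail d e _ hde ih =>
      obtain ⟨k, hk⟩ := ih
      refine ⟨k + 1, ?_⟩
      rw [pow_succ, Matrix.mul_apply]
      exact Finset.sum_pos' (fun d _ => mul_nonneg (hpow k _ _) (hnn _ _))
        ⟨d, mem_univ d, mul_pos hk hde⟩
  have hexp : 0 < NormedSpace.exp (t • rateMatrix m x T) c c' := by
    have hs := hasSum_exp_apply (t • rateMatrix m x T) c c'
    have hterm : ∀ i : ℕ, (i.factorial⁻¹ : ℝ) * ((t • rateMatrix m x T) ^ i) c c' =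
        (i.factorial⁻¹ : ℝ) * (t ^ i * (rateMatrix m x T ^ i) c c') := by
      intro i
      rw [smul_pow, Matrix.smul_apply, smul_eq_mul]
    simp only [hterm] at hs
    have hk' : 0 < (k.factorial⁻¹ : ℝ) * (t ^ k * (rateMatrix m x T ^ k) c c') := by positivity
    refine hk'.trans_le (le_hasSum hs k fun i _ => ?_)
    have := hpow i c c'
    positivity
  rw [transitionProb, generator_eq, smul_add, smul_smul, Matrix.exp_add_of_commute, exp_smul_one,
    Matrix.mul_smul, mul_one, Matrix.smul_apply, smul_eq_mul]
  · exact mul_pos (Real.exp_pos _) hexp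
  · exact (Commute.one_right _).smul_right _

theorem IsStationaryDistribution.unique {m : ℕ} {x : ℕ → ℝ} {T : ℕ → S → S}
    (hpos : ∀ c c', 0 < transitionProb (generator m x T) 1 c c') {p q : S → ℝ}
    (hp : IsStationaryDistribution (generator m x T) p)
    (hq : IsStationaryDistribution (generator m x T) q) : q = p := by
  refine sub_eq_zero.1 (eq_zero_of_pos_invariant hpos (fun c => ?_) (fun c' => ?_) ?_)
  · refine sum_exp_apply_eq_one _ (fun c => ?_) c
    rw [one_smul]
    exact generator_row_sum m x T c
  · simp only [Pi.sub_apply, sub_mul, Finset.sum_sub_distrib, hp.2.2 1 zero_le_one,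
      hq.2.2 1 zero_le_one]
  · simp [hp.2.1, hq.2.1]

theorem isStationaryDistribution_of_balance {Q : Matrix S S ℝ} {p : S → ℝ} (h0 : ∀ c, 0 ≤ p c)
    (h1 : ∑ c, p c = 1) (hQ : ∀ c', ∑ c, p c * Q c c' = 0) : IsStationaryDistribution Q p := by
  refine ⟨h0, h1, fun t _ c' => congrFun (vecMul_exp_of_vecMul_eq_zero p (t • Q) ?_) c'⟩
  rw [Matrix.vecMul_smul, show Matrix.vecMul p Q = 0 from funext hQ, smul_zero]

end ChainTheory

/-! ### The chain on compositions: inflow, total mass, irreducibility -/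

section Compositions

variable {n : ℕ} {x : ℕ → ℝ}

theorem removeBall_concat (l : List ℕ) (a : ℕ) :
    removeBall (l ++ [a]) = if a ≤ 1 then l else l ++ [a - 1] := by
  simp [removeBall]

theorem removeBall_append (l₁ l₂ : List ℕ) (h : l₂ ≠ []) :
    removeBall (l₁ ++ l₂) = l₁ ++ removeBall l₂ := by
  obtain ⟨l, a, rfl⟩ : ∃ l a, l₂ = l ++ [a] :=
    ⟨l₂.dropLast, l₂.getLast h, (List.dropLast_append_getLast h).symm⟩
  rw [← List.append_assoc, removeBall_concat, removeBall_concat]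
  split_ifs <;> simp

theorem length_removeBall_le (l : List ℕ) : (removeBall l).length ≤ l.length := by
  rcases List.eq_nil_or_concat l with rfl | ⟨l, a, rfl⟩
  · simp [removeBall]
  · rw [List.concat_eq_append, removeBall_concat]
    split_ifs <;> simp

theorem removeBall_eq_nil_iff {l : List ℕ} (hl : ∀ i ∈ l, 0 < i) (h0 : l ≠ []) :
    removeBall l = [] ↔ l = [1] := by
  obtain ⟨l, a, rfl⟩ : ∃ l' a, l = l' ++ [a] :=
    ⟨l.dropLast, l.getLast h0, (List.dropLast_append_getLast h0).symm⟩
  have ha : 0 < a := hl a (by simp)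
  rw [removeBall_concat]
  cases l with
  | nil => simp; omega
  | cons b l => split_ifs <;> simp

theorem removeBall_eq_concat_iff {l γ : List ℕ} {h : ℕ} (hl : ∀ i ∈ l, 0 < i) (h0 : l ≠ [])
    (hh : 0 < h) :
    removeBall l = γ ++ [h] ↔ l = γ ++ [h] ++ [1] ∨ l = γ ++ [h + 1] := by
  obtain ⟨l, a, rfl⟩ : ∃ l' a, l = l' ++ [a] :=
    ⟨l.dropLast, l.getLast h0, (List.dropLast_append_getLast h0).symm⟩
  have ha : 0 < a := hl a (by simp)
  rw [removeBall_concat]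
  by_cases h1 : a ≤ 1
  · obtain rfl : a = 1 := by omega
    simp only [le_refl, if_true, List.append_left_inj]
    constructor
    · exact Or.inl
    · rintro (h2 | h2)
      · exact h2
      · have := (List.append_inj' h2 rfl).2
        simp at this
        omega
  · rw [if_neg h1]
    constructor
    · intro h2
      have h3 := List.append_inj' h2 rfl
      have h4 : a - 1 = h := by simpa using h3.2
      right
      rw [h3.1, ← h4, Nat.sub_add_cancel ha]
    · rintro (h2 | h2)
      · have := (List.append_inj' h2 rfl).2
        simp at this
        omega
      · have h3 := List.append_inj' h2 rfl
        have h4 : a = h + 1 := by simpa using h3.2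
        rw [h3.1, h4, Nat.add_sub_cancel]

theorem sum_ite_blocks_eq {l : List ℕ} (hl : ∀ i ∈ l, 0 < i) (hs : l.sum = n) (f : List ℕ → ℝ) :
    ∑ c : Composition n, (if c.blocks = l then f c.blocks else 0) = f l := by
  have : ∀ c : Composition n, c.blocks = l ↔ c = ⟨l, fun hi => hl _ hi, hs⟩ := fun c =>
    ⟨fun h => Composition.ext h, fun h => h ▸ rfl⟩
  simp only [this]
  simp

theorem blocks_ne_nil (hn : 1 ≤ n) (c : Composition n) : c.blocks ≠ [] := by
  intro h
  have := c.blocks_sum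
  rw [h] at this
  simp at this
  omega

/-- The candidate for the stationary probability of a composition. -/
noncomputable def statProb (x : ℕ → ℝ) (c : Composition n) : ℝ :=
  statWeight x (c.blocks.map (· - 1))

/-- For nonempty `b` the preimages under `removeBall` are `b ++ [1]` and `b` with its last part
raised. Their weights are `W(b)` and `π(b) - W(b)` in terms of the parts minus one, so `W(b)`
cancels. -/
theorem sum_removeBall_eq {b : List ℕ} (hb : ∀ i ∈ b, 0 < i) (hs : b.sum + 1 = n) (x : ℕ → ℝ) :
    ∑ c : Composition n, (if removeBall c.blocks = b then statProb x c else 0) =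
      statWeight x (b.map (· - 1)) := by
  set f : List ℕ → ℝ := fun l => statWeight x (l.map (· - 1)) with hf
  have hpos : ∀ c : Composition n, ∀ i ∈ c.blocks, 0 < i := fun c i hi => c.blocks_pos hi
  have hne : ∀ c : Composition n, c.blocks ≠ [] := blocks_ne_nil (by omega)
  rcases List.eq_nil_or_concat b with rfl | ⟨γ, h, rfl⟩
  · simp only [removeBall_eq_nil_iff (hpos _) (hne _)]
    refine (sum_ite_blocks_eq (by simp) (by simpa using hs) f).trans ?_
    simpa [hf, statWeight_nil, weightSum_nil] using statWeight_append_zero x []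
  · rw [List.concat_eq_append] at *
    have hh : 0 < h := hb h (by simp)
    have hγ : ∀ i ∈ γ, 0 < i := fun i hi => hb i (by simp [hi])
    have hsplit : ∀ c : Composition n,
        (if removeBall c.blocks = γ ++ [h] then statProb x c else 0) =
        (if c.blocks = γ ++ [h] ++ [1] then f c.blocks else 0) +
        (if c.blocks = γ ++ [h + 1] then f c.blocks else 0) := by
      intro c
      simp only [removeBall_eq_concat_iff (hpos c) (hne c) hh]
      by_cases h1 : c.blocks = γ ++ [h] ++ [1]
      · have h2 : c.blocks ≠ γ ++ [h + 1] := by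
          rw [h1]
          intro h2
          have := (List.append_inj' h2 rfl).2
          simp at this
          omega
        rw [if_pos (Or.inl h1), if_pos h1, if_neg h2, add_zero]
        rfl
      · simp only [h1, false_or, if_false, zero_add]
        rfl
    rw [Finset.sum_congr rfl fun c _ => hsplit c, Finset.sum_add_distrib,
      sum_ite_blocks_eq _ (by simp at hs ⊢; omega) f, sum_ite_blocks_eq _ (by simp at hs ⊢; omega) f]
    · obtain ⟨h, rfl⟩ : ∃ h', h = h' + 1 := ⟨h - 1, by omega⟩
      simp only [hf, List.map_append, List.map_cons, List.map_nil, Nat.sub_self,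
        statWeight_append_zero, Nat.add_sub_cancel, statWeight_append_succ]
      ring
    · intro i hi
      rcases List.mem_append.1 hi with hi | hi
      · exact hγ i hi
      · simp at hi; omega
    · intro i hi
      rcases List.mem_append.1 hi with hi | hi
      · exact hb i hi
      · simp at hi; omega

/-- Only the preimage `b ++ [1]` is longer than `b`. This is the case of a ball added to the last
bin of `b`, allowed only if the removal deleted a bin. -/
theorem sum_removeBall_eq_lt {b : List ℕ} (hb : ∀ i ∈ b, 0 < i) (hs : b.sum + 1 = n)
    (x : ℕ → ℝ) :
    ∑ c : Composition n, (if b.length < c.blocks.length ∧ removeBall c.blocks = b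
      then statProb x c else 0) = weightSum x (b.map (· - 1)) := by
  have hiff : ∀ c : Composition n, (b.length < c.blocks.length ∧ removeBall c.blocks = b) ↔
      c.blocks = b ++ [1] := by
    intro c
    have hpos : ∀ i ∈ c.blocks, 0 < i := fun i hi => c.blocks_pos hi
    have hne : c.blocks ≠ [] := blocks_ne_nil (by omega) c
    rcases List.eq_nil_or_concat b with rfl | ⟨γ, h, rfl⟩
    · rw [removeBall_eq_nil_iff hpos hne]
      exact ⟨fun h => h.2, fun h => ⟨by rw [h]; simp, h⟩⟩
    · rw [List.concat_eq_append] at *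
      rw [removeBall_eq_concat_iff hpos hne (hb h (by simp))]
      constructor
      · rintro ⟨h1, h2 | h2⟩
        · exact h2
        · rw [h2] at h1; simp at h1
      · intro h1
        exact ⟨by rw [h1]; simp, Or.inl h1⟩
  simp only [hiff]
  refine (sum_ite_blocks_eq ?_ (by simpa using hs) fun l => statWeight x (l.map (· - 1))).trans ?_
  · intro i hi
    rcases List.mem_append.1 hi with hi | hi
    · exact hb i hi
    · simp at hi; omega
  · simpa using statWeight_append_zero x (b.map (· - 1))

/-- By `sum_removeBall_eq`, removing a ball pushes the weights on compositions of `n + 1` forward to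
those on compositions of `n`. -/
theorem sum_statProb (x : ℕ → ℝ) (n : ℕ) : ∑ c : Composition n, statProb x c = 1 := by
  induction n with
  | zero =>
    have h1 : ∀ c : Composition 0, c.blocks = [] := fun c =>
      List.length_eq_zero_iff.1 (Nat.le_zero.1 c.length_le)
    have h2 := sum_ite_blocks_eq (n := 0) (l := []) (by simp) rfl
      (fun l => statWeight x (l.map (· - 1)))
    simpa [h1, statProb, statWeight_nil] using h2
  | succ n ih =>
    rw [← ih]
    have h1 : ∀ b : Composition n, statProb x b =
        ∑ c : Composition (n + 1), (if removeBall c.blocks = b.blocks then statProb x c else 0) :=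
      fun b => (sum_removeBall_eq (fun i hi => b.blocks_pos hi) (by rw [b.blocks_sum]) x).symm
    rw [Finset.sum_congr rfl fun b _ => h1 b, Finset.sum_comm]
    refine Finset.sum_congr rfl fun c _ => ?_
    have hpos : ∀ i ∈ c.blocks, 0 < i := fun i hi => c.blocks_pos hi
    have hsum := removeBall_sum hpos (blocks_ne_nil (by omega) c)
    rw [c.blocks_sum] at hsum
    have hiff : ∀ b : Composition n, removeBall c.blocks = b.blocks ↔
        b.blocks = removeBall c.blocks := fun b => eq_comm
    simp only [hiff]
    exact (sum_ite_blocks_eq (n := n) (removeBall_pos hpos) (by omega) fun _ => statProb x c).symm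

theorem T_blocks {j : ℕ} {c : Composition n} (h : j < c.blocks.length) :
    (T j c).blocks = addBall j (removeBall c.blocks) := by
  rw [T, dif_pos h]

theorem T_of_le {j : ℕ} {c : Composition n} (h : ¬ j < c.blocks.length) : T j c = c := by
  rw [T, dif_neg h]

theorem sum_inflow_zero (hn : 1 ≤ n) (x : ℕ → ℝ) (c' : Composition n) :
    ∑ c : Composition n, (if 0 < c.blocks.length ∧ addBall 0 (removeBall c.blocks) = c'.blocks
      then statProb x c else 0) = shiftTerm (statWeight x) (c'.blocks.map (· - 1)) := by
  have hlen : ∀ c : Composition n, 0 < c.blocks.length := fun c =>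
    List.length_pos_of_ne_nil (blocks_ne_nil hn c)
  have hpos : ∀ i ∈ c'.blocks, 0 < i := fun i hi => c'.blocks_pos hi
  have hsum := c'.blocks_sum
  have hne := blocks_ne_nil hn c'
  simp only [hlen, true_and, addBall]
  generalize c'.blocks = l at *
  obtain _ | ⟨a, t⟩ := l
  · exact absurd rfl hne
  · obtain ⟨a, rfl⟩ : ∃ a', a = a' + 1 := ⟨a - 1, by have := hpos a (by simp); omega⟩
    cases a with
    | zero =>
      simp only [List.cons.injEq, zero_add, true_and]
      exact sum_removeBall_eq (fun i hi => hpos i (by simp [hi])) (by simp at hsum; omega) x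
    | succ a =>
      refine Finset.sum_eq_zero fun c _ => if_neg fun h => ?_
      simp at h

theorem modify_succ_eq_iff {l₁ l₂ : List ℕ} {k : ℕ} (h : l₂.getD k 0 ≠ 0) :
    l₁.modify k (· + 1) = l₂ ↔ l₁ = l₂.modify k (· - 1) := by
  induction k generalizing l₁ l₂ with
  | zero => cases l₁ <;> cases l₂ <;> simp_all; omega
  | succ k ih => cases l₁ <;> cases l₂ <;> simp_all

theorem map_pred_modify (l : List ℕ) (k : ℕ) :
    (l.modify k (· - 1)).map (· - 1) = (l.map (· - 1)).modify k (· - 1) := by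
  induction l generalizing k with
  | nil => simp
  | cons a l ih => cases k <;> simp [ih]

theorem modify_pred_pos (l : List ℕ) (k : ℕ) (hl : ∀ i ∈ l, 0 < i) (hk : l.getD k 0 ≠ 1) :
    ∀ i ∈ l.modify k (· - 1), 0 < i := by
  induction l generalizing k with
  | nil => simp
  | cons a l ih =>
    cases k with
    | zero => intro i hi; simp at hi hk; grind
    | succ k => intro i hi; simp at hi hk; grind

theorem getD_modify_succ (l : List ℕ) (k : ℕ) (hk : k < l.length) :
    (l.modify k (· + 1)).getD k 0 = l.getD k 0 + 1 := by
  rw [List.getD_eq_getElem _ _ (by simpa using hk), List.getD_eq_getElem _ _ hk,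
    List.getElem_modify, if_pos rfl]

theorem getD_pos {l : List ℕ} (hl : ∀ i ∈ l, 0 < i) {k : ℕ} (hk : k < l.length) :
    0 < l.getD k 0 := by
  rw [List.getD_eq_getElem _ _ hk]
  exact hl _ (List.getElem_mem hk)

theorem getD_map_pred (l : List ℕ) (k : ℕ) : (l.map (· - 1)).getD k 0 = l.getD k 0 - 1 := by
  by_cases hk : k < l.length
  · rw [List.getD_eq_getElem _ _ (by simpa using hk), List.getD_eq_getElem _ _ hk,
      List.getElem_map]
  · rw [List.getD_eq_default _ _ (by simpa using hk), List.getD_eq_default _ _ (by omega)]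

/-- The intermediate list is `c'` with its part at index `k` lowered, which requires that part to be
at least two. For `k + 1 < ℓ`, `ℓ` the length of `c'`, the condition on the length of `c` is
automatic; for `k + 1 = ℓ` it forces `c` to be longer. -/
theorem sum_inflow_succ (x : ℕ → ℝ) (c' : Composition n) (k : ℕ) :
    ∑ c : Composition n, (if k + 1 < c.blocks.length ∧
      addBall (k + 1) (removeBall c.blocks) = c'.blocks then statProb x c else 0) =
      if (c'.blocks.map (· - 1)).getD k 0 = 0 then 0 else
        if k + 1 < (c'.blocks.map (· - 1)).length then
          statWeight x ((c'.blocks.map (· - 1)).modify k (· - 1))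
        else weightSum x ((c'.blocks.map (· - 1)).modify k (· - 1)) := by
  have hpos : ∀ i ∈ c'.blocks, 0 < i := fun i hi => c'.blocks_pos hi
  have hsum := c'.blocks_sum
  simp only [addBall]
  generalize c'.blocks = l at *
  rw [getD_map_pred, List.length_map]
  by_cases h0 : l.getD k 0 - 1 = 0
  · rw [if_pos h0]
    refine Finset.sum_eq_zero fun c _ => if_neg ?_
    rintro ⟨h1, h2⟩
    have hk : k < (removeBall c.blocks).length := by
      have := removeBall_length c.blocks
      omega
    have h3 := getD_modify_succ _ _ hk
    rw [h2] at h3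
    have := getD_pos (removeBall_pos fun i hi => c.blocks_pos hi) hk
    omega
  · have hk : k < l.length := by
      by_contra hk
      rw [List.getD_eq_default _ _ (by omega)] at h0
      exact h0 rfl
    have hbpos := modify_pred_pos l k hpos (by omega)
    have hbsum := sum_modify_pred l k (by omega)
    rw [if_neg h0, ← map_pred_modify]
    simp only [modify_succ_eq_iff (show l.getD k 0 ≠ 0 by omega)]
    split_ifs with h1
    · rw [← sum_removeBall_eq hbpos (hbsum.trans hsum)]
      refine Finset.sum_congr rfl fun c _ => ?_
      congr 1
      refine propext ⟨fun h => h.2, fun h => ⟨?_, h⟩⟩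
      have := length_removeBall_le c.blocks
      rw [h, List.length_modify] at this
      omega
    · rw [← sum_removeBall_eq_lt hbpos (hbsum.trans hsum), List.length_modify,
        show l.length = k + 1 by omega]

theorem statProb_balance (hn : 1 ≤ n) (hx : ∀ i ≤ n, 0 ≤ x i) (hx0 : 0 < x 0)
    (c' : Composition n) : ∑ c, statProb x c * ballProjection n x c c' = 0 := by
  set l := c'.blocks.map (· - 1) with hl
  have hlen : l.length = c'.blocks.length := by simp [hl]
  have hne : l ≠ [] := by simpa [hl] using blocks_ne_nil hn c'
  have hle : l.length ≤ n := hlen ▸ c'.length_le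
  have hl1 : 0 < l.length := List.length_pos_of_ne_nil hne
  set I : ℕ → ℝ := fun j => ∑ c : Composition n, (if j < c.blocks.length ∧
      addBall j (removeBall c.blocks) = c'.blocks then statProb x c else 0) with hI
  have hflow : ∀ j, ∑ c : Composition n,
      statProb x c * ((if T j c = c' then 1 else 0) - (if c = c' then 1 else 0)) =
      I j - if j < l.length then statProb x c' else 0 := by
    intro j
    have hc : ∀ c : Composition n,
        statProb x c * ((if T j c = c' then 1 else 0) - (if c = c' then 1 else 0)) =
        (if j < c.blocks.length ∧ addBall j (removeBall c.blocks) = c'.blocks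
          then statProb x c else 0) -
        (if c = c' then (if j < l.length then statProb x c' else 0) else 0) := by
      intro c
      by_cases hj : j < c.blocks.length
      · have hiff : T j c = c' ↔ addBall j (removeBall c.blocks) = c'.blocks := by
          rw [← T_blocks hj]
          exact ⟨fun h => h ▸ rfl, fun h => Composition.ext h⟩
        have h2 : (if c = c' then (if j < l.length then statProb x c' else 0) else 0) =
            if c = c' then statProb x c else 0 := by
          split_ifs with h h'
          · rw [h]
          · subst h; exact absurd (hlen ▸ hj) h'
          · rfl
        simp only [hj, true_and, hiff, h2, mul_sub, mul_ite, mul_one, mul_zero]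
      · have h2 : (if c = c' then (if j < l.length then statProb x c' else 0) else 0) = 0 := by
          split_ifs with h h'
          · subst h; exact absurd (hlen ▸ h') hj
          · rfl
          · rfl
        rw [T_of_le hj, sub_self, mul_zero, if_neg (fun h => hj h.1), h2, sub_zero]
    rw [Finset.sum_congr rfl fun c _ => hc c, Finset.sum_sub_distrib, Finset.sum_ite_eq',
      if_pos (mem_univ _)]
  have hQ : ∑ c, statProb x c * ballProjection n x c c' =
      ∑ j ∈ range n, x j * (I j - if j < l.length then statProb x c' else 0) := by
    simp only [ballProjection, generator, Matrix.of_apply, Finset.mul_sum]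
    rw [Finset.sum_comm]
    refine Finset.sum_congr rfl fun j _ => ?_
    rw [← hflow, Finset.mul_sum]
    exact Finset.sum_congr rfl fun c _ => by ring
  have hout : ∑ j ∈ range n, x j * (if j < l.length then statProb x c' else 0) =
      y x (l.length - 1) * statProb x c' := by
    rw [y, Nat.sub_add_cancel hl1, Finset.sum_mul]
    simp only [mul_ite, mul_zero]
    rw [← Finset.sum_filter]
    refine Finset.sum_congr ?_ fun _ _ => rfl
    ext j
    simp only [mem_filter, mem_range]
    omega
  have hin : ∑ j ∈ range n, x j * I j = y x (l.length - 1) * statProb x c' := by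
    obtain ⟨N, rfl⟩ : ∃ N, n = N + 1 := ⟨n - 1, by omega⟩
    have hIz : I 0 = shiftTerm (statWeight x) l := sum_inflow_zero hn x c'
    have hIs : ∀ k, I (k + 1) = if l.getD k 0 = 0 then 0 else
        if k + 1 < l.length then statWeight x (l.modify k (· - 1))
        else weightSum x (l.modify k (· - 1)) := sum_inflow_succ x c'
    -- The chain uses only the rates `x_j` with `j < n`, while `statWeight_balance` runs up to
    -- `x_ℓ`. A part of size at least two forces `ℓ < n`, so the possible term with `x_n` vanishes.
    have hsmall : ∀ k, l.getD k 0 ≠ 0 → k < l.length ∧ k < N := by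
      intro k hk
      have h1 : k < l.length := by
        by_contra h
        exact hk (List.getD_eq_default _ _ (by omega))
      refine ⟨h1, ?_⟩
      rw [hl, getD_map_pred] at hk
      have h2 := sum_modify_pred c'.blocks k (by omega)
      have h3 : ∀ i ∈ c'.blocks.modify k (· - 1), 1 ≤ i :=
        modify_pred_pos c'.blocks k (fun i hi => c'.blocks_pos hi) (by omega)
      have h4 := List.length_le_sum_of_one_le _ h3
      rw [List.length_modify] at h4
      rw [c'.blocks_sum] at h2
      omega
    rw [Finset.sum_range_succ', hIz]
    refine Eq.trans ?_ (statWeight_balance hx hx0 l hne hle).symm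
    rw [add_comm]
    congr 1
    simp only [hIs]
    have hext : ∀ s t : Finset ℕ, (∀ k, l.getD k 0 ≠ 0 → (k ∈ s ↔ k ∈ t)) → ∀ f : ℕ → ℝ,
        ∑ k ∈ s, x (k + 1) * (if l.getD k 0 = 0 then 0 else f k) =
        ∑ k ∈ t, x (k + 1) * (if l.getD k 0 = 0 then 0 else f k) := by
      intro s t hst f
      simp only [mul_ite, mul_zero, ← ite_not (l.getD _ 0 = 0)]
      rw [← Finset.sum_filter, ← Finset.sum_filter]
      refine Finset.sum_congr ?_ fun _ _ => rfl
      ext k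
      simp only [mem_filter]
      exact and_congr_left (hst k)
    refine hext _ _ (fun k hk => ?_) _
    simp only [mem_range, hsmall k hk]
  rw [hQ]
  simp only [mul_sub, Finset.sum_sub_distrib]
  rw [hout, hin, sub_self]

/-- Build `b` from its last bin leftwards, ball by ball: `T 0` opens a bin of size one, `T 1`
enlarges the leftmost bin. -/
theorem exists_reachable_prefix {R : Composition n → Composition n → Prop}
    (h0 : ∀ c, R c (T 0 c)) (h1 : 1 < n → ∀ c, R c (T 1 c)) (c : Composition n) (b : List ℕ)
    (hb : ∀ i ∈ b, 0 < i) (hs : b.sum ≤ n) :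
    ∃ c', Relation.ReflTransGen R c c' ∧ ∃ r, c'.blocks = b ++ r := by
  induction hN : b.sum generalizing b with
  | zero =>
    cases b with
    | nil => exact ⟨c, .refl, c.blocks, rfl⟩
    | cons a b => have := hb a (by simp); simp at hN; omega
  | succ N ih =>
    obtain _ | ⟨a, b⟩ := b
    · simp at hN
    have ha := hb a (by simp)
    have hb' : ∀ i ∈ b, 0 < i := fun i hi => hb i (by simp [hi])
    rw [List.sum_cons] at hN hs
    -- While the prefix has fewer than `n` balls something remains to its right, so the removed ball
    -- never comes from the prefix.
    have hrest : ∀ (d : Composition n) (l r : List ℕ), d.blocks = l ++ r → l.sum = N → r ≠ [] := by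
      rintro d l r h h2 rfl
      have := d.blocks_sum
      rw [h, List.append_nil] at this
      omega
    by_cases ha1 : a = 1
    · subst ha1
      obtain ⟨d, hd, r, hr⟩ := ih b hb' (by omega) (by omega)
      have hr0 := hrest d b r hr (by omega)
      refine ⟨T 0 d, hd.tail (h0 d), removeBall r, ?_⟩
      rw [T_blocks (List.length_pos_of_ne_nil (by simp [hr, hr0])), hr, removeBall_append _ _ hr0]
      rfl
    · obtain ⟨a, rfl⟩ : ∃ a', a = a' + 1 := ⟨a - 1, by omega⟩
      obtain ⟨d, hd, r, hr⟩ := ih (a :: b)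
        (by intro i hi; rcases List.mem_cons.1 hi with rfl | hi; omega; exact hb' i hi)
        (by simp; omega) (by simp; omega)
      have hr0 := hrest d (a :: b) r hr (by simp; omega)
      refine ⟨T 1 d, hd.tail (h1 (by omega) d), removeBall r, ?_⟩
      have := List.length_pos_of_ne_nil hr0
      rw [T_blocks (by rw [hr]; simp; omega), hr, removeBall_append _ _ hr0]
      simp [addBall]

theorem ballProjection_pos (hn : 1 ≤ n) (hx : ∀ i ≤ n, 0 ≤ x i) (hx0 : 0 < x 0) (hx1 : 0 < x 1)
    (c c' : Composition n) {t : ℝ} (ht : 0 < t) :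
    0 < transitionProb (ballProjection n x) t c c' := by
  refine transitionProb_pos (fun j hj => hx j hj.le) ?_ ht
  have hrate : ∀ j < n, 0 < x j → ∀ c : Composition n, 0 < rateMatrix n x T c (T j c) := by
    intro j hj hxj c
    refine Finset.sum_pos' (fun i hi => mul_nonneg (hx i (mem_range.1 hi).le)
      (by split_ifs <;> norm_num)) ⟨j, mem_range.2 hj, ?_⟩
    simpa using hxj
  obtain ⟨d, hd, r, hr⟩ := exists_reachable_prefix
    (R := fun c c' => 0 < rateMatrix n x T c c') (hrate 0 (by omega) hx0)
    (fun h => hrate 1 h hx1) c c'.blocks (fun i hi => c'.blocks_pos hi) c'.blocks_sum.le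
  have h1 : c'.blocks.sum = d.blocks.sum := c'.blocks_sum.trans d.blocks_sum.symm
  have h2 : r = [] := by
    cases r with
    | nil => rfl
    | cons a r =>
      have ha : 0 < a := d.blocks_pos (by rw [hr]; simp)
      rw [hr] at h1
      simp at h1
      omega
  obtain rfl : d = c' := Composition.ext (by rw [hr, h2, List.append_nil])
  exact hd

end Compositions
end HilbertGalton

theorem theorem2p4 (n : ℕ) (hn : 1 ≤ n) (x : ℕ → ℝ) (hx : ∀ i ≤ n, 0 ≤ x i)
    (hx0 : 0 < x 0) (hx1 : 0 < x 1) :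
    HilbertGalton.IsIrreducibleChain (HilbertGalton.ballProjection n x) ∧
    ∃ p : Composition n → ℝ,
      HilbertGalton.IsStationaryDistribution (HilbertGalton.ballProjection n x) p ∧
      (∀ q : Composition n → ℝ,
        HilbertGalton.IsStationaryDistribution (HilbertGalton.ballProjection n x) q → q = p) ∧
      -- `c = (γ_1 + 1, …, γ_ℓ + 1)` with `γ = (γ_1, …, γ_{ℓ-1})` and `g = γ_ℓ`
      ∀ (c : Composition n) (γ : List ℕ) (g : ℕ), c.blocks = (γ ++ [g]).map (· + 1) →
        p c = HilbertGalton.weightSum x γ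
            - ∑ s ∈ Finset.range g, HilbertGalton.weightSum x (γ ++ [s]) ∧
        HasSum (fun s : Set.Ici g => HilbertGalton.weightSum x (γ ++ [(s : ℕ)])) (p c) := by
  have hpos := HilbertGalton.ballProjection_pos hn hx hx0 hx1
  have hstat : HilbertGalton.IsStationaryDistribution (HilbertGalton.ballProjection n x)
      (HilbertGalton.statProb x) :=
    HilbertGalton.isStationaryDistribution_of_balance
      (fun c => HilbertGalton.statWeight_nonneg hx hx0 _ (by simp))
      (HilbertGalton.sum_statProb x n) (HilbertGalton.statProb_balance hn hx hx0)
  refine ⟨fun c c' => ⟨1, one_pos, hpos c c' one_pos⟩, HilbertGalton.statProb x, hstat,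
    fun q hq => HilbertGalton.IsStationaryDistribution.unique (fun c c' => hpos c c' one_pos)
      hstat hq, fun c γ g hc => ?_⟩
  have hp : HilbertGalton.statProb x c = HilbertGalton.statWeight x (γ ++ [g]) := by
    rw [HilbertGalton.statProb, hc, List.map_map]
    simp [Function.comp_def]
  have hlen : γ.length < n := by
    have h1 := congrArg List.length hc
    have h2 : c.blocks.length ≤ n := c.length_le
    rw [List.length_map, List.length_append, List.length_singleton] at h1
    omega
  rw [hp]
  exact ⟨HilbertGalton.statWeight_append x γ g, HilbertGalton.hasSum_statWeight hx hx0 γ g hlen⟩
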